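/- Let $K$ be a field and $n\in\mathbb N$. A simplicial complex on $[n]=\{1,\dots,n\}$ is a family $\Delta\subseteq 2^{[n]}$ closed under taking subsets; its rank is $\operatorname{rk}\Delta=\max\{|F| : F\in\Delta\}$, and for $A\subseteq[n]$ we put $\operatorname{link}_\Delta A=\{B\in\Delta : B\cap A=\emptyset,\ B\cup A\in\Delta\}$, again a simplicial complex on $[n]$ (it is the void complex $\emptyset$ if $A\notin\Delta$). Let $S=K[x_1,\dots,x_n]$, let $I_\Delta\subseteq S$ be the ideal generated by the monomials $\prod_{i\in F}x_i$ with $F\subseteq[n]$, $F\notin\Delta$, and let $T^1(\Delta)$ be the cokernel of the natural map $\operatorname{Der}_K(S,S)\to\operatorname{Hom}_S(I_\Delta,S/I_\Delta)$, $D\mapsto (f\mapsto D(f)+I_\Delta)$. The complex $\Delta$ is called rigid if $T^1(\Delta)=0$. A matroid on $[n]$ is identified with the simplicial complex of its independent sets; it is called discrete if each of its elements is a loop or a coloop. Maxima are over subsets $A\subseteq[n]$, with $\max\emptyset=-\infty$ (and $\operatorname{rk}\emptyset=0$ for the void complex). Then: (i) For every simplicial complex $\Delta$ on $[n]$, $$\operatorname{rk}\Delta\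 \ge\ 1+\max\{|A| : T^1(\operatorname{link}_\Delta A)\ne 0\}.$$ (ii) If $\Delta$ is a matroid on $[n]$ without coloops and $A\in\Delta$, then $\operatorname{link}_\Delta A$ is rigid if and only if $A$ is a basis of $\Delta$. (iii) If $\Delta$ is a matroid on $[n]$ that is not discrete, then $$\operatorname{rk}\Delta\ =\ 1+\max\{|A| : T^1(\operatorname{link}_\Delta A)\ne 0\}.$$ -/

import Mathlib

namespace StanleyReisner

/-- A simplicial complex on the vertex set `[n]`: a family of subsets of `[n]` closed under passing
to subsets. Vertices need not be faces, and both the void complex `∅` and the complex `{∅}` are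
allowed. -/
abbrev SimplicialComplex (n : ℕ) := LowerSet (Finset (Fin n))

open Classical in
/-- `rk Δ`, the maximal cardinality of a face of `Δ` (the void complex gets the value `0`). -/
noncomputable def rank {n : ℕ} (Δ : SimplicialComplex n) : ℕ :=
  (Finset.univ.filter fun F : Finset (Fin n) => F ∈ Δ).sup Finset.card

/-- The link `{B ∈ Δ : B ∩ A = ∅, B ∪ A ∈ Δ}`, again a complex on `[n]`.
It is the void complex if `A` is not a face. -/
def link {n : ℕ} (Δ : SimplicialComplex n) (A : Finset (Fin n)) : SimplicialComplex n where
  carrier := {B | B ∈ Δ ∧ B ∩ A = ∅ ∧ B ∪ A ∈ Δ}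
  lower' := by
    rintro B C hCB ⟨hB, hBA, hU⟩
    refine ⟨Δ.lower hCB hB, ?_, Δ.lower (Finset.union_subset_union_left hCB) hU⟩
    exact Finset.subset_empty.mp (hBA ▸ Finset.inter_subset_inter_right hCB)

/-- The simplicial complex of independent sets of a matroid with elements in `[n]`. -/
def indepComplex {n : ℕ} (M : Matroid (Fin n)) : SimplicialComplex n where
  carrier := {F | M.Indep (F : Set (Fin n))}
  lower' := fun _ _ h hF => Matroid.Indep.subset hF (Finset.coe_subset.mpr h)

/-- A discrete matroid: every element of the ground set is a loop or a coloop. -/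
def IsDiscrete {n : ℕ} (M : Matroid (Fin n)) : Prop :=
  ∀ v ∈ M.E, M.IsLoop v ∨ M.IsColoop v

/-- The Stanley-Reisner ideal of `Δ` in `K[x₁, …, xₙ]`, generated by the squarefree monomials of
all nonfaces. -/
noncomputable def stanleyReisnerIdeal (K : Type*) [Field K] {n : ℕ} (Δ : SimplicialComplex n) :
    Ideal (MvPolynomial (Fin n) K) :=
  Ideal.span {p | ∃ F : Finset (Fin n), F ∉ Δ ∧ p = ∏ i ∈ F, MvPolynomial.X i}

/-- The natural `S`-linear map `Der_K(S, S) → Hom_S(I, S/I)` that sends a derivation `D` to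
`f ↦ D f + I`. -/
def derToHom (K : Type*) {S : Type*} [CommRing K] [CommRing S] [Algebra K S] (I : Ideal S) :
    Derivation K S S →ₗ[S] (I →ₗ[S] S ⧸ I) where
  toFun D :=
    { toFun := fun f => Ideal.Quotient.mk I (D f)
      map_add' := fun f g => by simp
      map_smul' := fun s f => by
        have h : Ideal.Quotient.mk I ((f : S) * D s) = 0 :=
          Ideal.Quotient.eq_zero_iff_mem.mpr (I.mul_mem_right _ f.2)
        simp [Algebra.smul_def, ← map_mul, h] }
  map_add' D E := by ext f; simp
  map_smul' s D := by ext f; simp [Algebra.smul_def]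

/-- The first cotangent cohomology module `T¹(S/I)` of a quotient of the polynomial ring `S`:
the cokernel of the natural map `Der_K(S, S) → Hom_S(I, S/I)`. -/
abbrev CotangentT1 (K : Type*) [Field K] {n : ℕ} (I : Ideal (MvPolynomial (Fin n) K)) : Type _ :=
  (I →ₗ[MvPolynomial (Fin n) K] MvPolynomial (Fin n) K ⧸ I) ⧸ LinearMap.range (derToHom K I)

/-- `T¹(Δ)`, the first cotangent cohomology of the Stanley-Reisner ring `K[Δ]`. -/
abbrev T1 (K : Type*) [Field K] {n : ℕ} (Δ : SimplicialComplex n) : Type _ :=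
  CotangentT1 K (stanleyReisnerIdeal K Δ)

/-- `Δ` is algebraically rigid over `K`: `T¹(Δ) = 0`. -/
def IsRigid (K : Type*) [Field K] {n : ℕ} (Δ : SimplicialComplex n) : Prop :=
  Subsingleton (T1 K Δ)

open Classical in
/-- `max {|A| : A ⊆ [n], T¹(link_Δ A) ≠ 0}`, where the maximum of the empty set is `⊥ = -∞`. -/
noncomputable def maxCardNonrigidLink (K : Type*) [Field K] {n : ℕ} (Δ : SimplicialComplex n) :
    WithBot ℕ :=
  ((Finset.univ.filter fun A : Finset (Fin n) => Nontrivial (T1 K (link Δ A))).image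
    Finset.card).max

end StanleyReisner

namespace StanleyReisner

open MvPolynomial

variable {K : Type*} [Field K] {n : ℕ}

/-! A non-face has void link, and a facet has link `{∅}`. Both are rigid: the ideal is the whole
ring, or the maximal ideal `(x₁, …, xₙ)`, on which every homomorphism is fixed by its values on the
variables. So a non-rigid link comes from a face that is not a facet, which gives (i). For matroids,
let `A ⊊ B` with `B` a basis and let `u ∈ B \ A` be no coloop. Basis exchange replaces `u` by some
`w ∉ B`, so in the link of `A` the face `(B \ A) \ {u}` has a link consisting of isolated points,
`u` and `w` among them. `not_isRigid_of_link_discrete_points` then writes down a monomial shift on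
`I_Δ` that no derivation induces. This gives (ii), and (iii) with `A = B \ {v}` for an element `v`
that is neither a loop nor a coloop. -/

/-! ### Monomials in the Stanley-Reisner ideal -/

theorem mem_stanleyReisnerIdeal_iff {Δ : SimplicialComplex n} {f : MvPolynomial (Fin n) K} :
    f ∈ stanleyReisnerIdeal K Δ ↔ ∀ p ∈ f.support, p.support ∉ Δ := by
  classical
  have hprod : ∀ F : Finset (Fin n), (∏ i ∈ F, (X i : MvPolynomial (Fin n) K)) =
      monomial (∑ i ∈ F, Finsupp.single i 1) 1 := fun F => by
    rw [monomial_sum_one]; rfl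
  have hset : {p | ∃ F : Finset (Fin n), F ∉ Δ ∧ p = ∏ i ∈ F, (X i : MvPolynomial (Fin n) K)} =
      (fun s => monomial s (1 : K)) ''
        ((fun F : Finset (Fin n) => ∑ i ∈ F, Finsupp.single i 1) '' {F | F ∉ Δ}) := by
    ext p
    simp only [Set.mem_ofPred_eq, Set.mem_image, exists_exists_and_eq_and, hprod]
    exact exists_congr fun F => and_congr_right fun _ => eq_comm
  have hle : ∀ (F : Finset (Fin n)) (p : Fin n →₀ ℕ),
      (∑ i ∈ F, Finsupp.single i 1) ≤ p ↔ F ⊆ p.support := fun F p => by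
    have happ : ∀ j, (∑ i ∈ F, Finsupp.single i 1 : Fin n →₀ ℕ) j = if j ∈ F then 1 else 0 := by
      intro j
      simp [Finsupp.finsetSum_apply, Finsupp.single_apply]
    constructor
    · intro h j hj
      have := h j
      rw [happ, if_pos hj] at this
      exact Finsupp.mem_support_iff.2 (by omega)
    · intro h j
      rw [happ]
      split_ifs with hj
      · have := Finsupp.mem_support_iff.1 (h hj)
        omega
      · exact Nat.zero_le _
  rw [stanleyReisnerIdeal, hset, mem_ideal_span_monomial_image]
  refine forall₂_congr fun p _ => ?_
  simp only [Set.exists_mem_image, Set.mem_ofPred_eq, hle]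
  exact ⟨fun ⟨F, hF, h⟩ hp => hF (Δ.lower h hp), fun h => ⟨_, h, subset_rfl⟩⟩

theorem coeff_eq_zero_of_mem_stanleyReisnerIdeal {Δ : SimplicialComplex n}
    {f : MvPolynomial (Fin n) K} (hf : f ∈ stanleyReisnerIdeal K Δ) {p : Fin n →₀ ℕ}
    (hp : p.support ∈ Δ) : coeff p f = 0 := by
  by_contra h
  exact mem_stanleyReisnerIdeal_iff.1 hf p (mem_support_iff.2 h) hp

theorem monomial_mem_stanleyReisnerIdeal {Δ : SimplicialComplex n} {p : Fin n →₀ ℕ}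
    (hp : p.support ∉ Δ) (k : K) : monomial p k ∈ stanleyReisnerIdeal K Δ := by
  classical
  refine mem_stanleyReisnerIdeal_iff.2 fun q hq => ?_
  rw [Finset.mem_singleton.1 (support_monomial_subset hq)]
  exact hp

/-! ### Rigidity of `{∅}` and of the void complex -/

theorem isRigid_iff {Δ : SimplicialComplex n} :
    IsRigid K Δ ↔ Function.Surjective (derToHom K (stanleyReisnerIdeal K Δ)) := by
  rw [IsRigid, T1, CotangentT1, Submodule.Quotient.subsingleton_iff, LinearMap.range_eq_top]

/-- The complex `{∅}`, whose Stanley-Reisner ideal is the maximal homogeneous ideal, is rigid. -/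
theorem isRigid_of_forall_mem_iff {Δ : SimplicialComplex n} (h : ∀ F, F ∈ Δ ↔ F = ∅) :
    IsRigid K Δ := by
  classical
  have hX : ∀ i, (X i : MvPolynomial (Fin n) K) ∈ stanleyReisnerIdeal K Δ := fun i =>
    monomial_mem_stanleyReisnerIdeal
      (by rw [h, Finsupp.support_single _ one_ne_zero]; simp) 1
  rw [isRigid_iff]
  intro φ
  choose g hg using fun i => Ideal.Quotient.mk_surjective (φ ⟨X i, hX i⟩)
  refine ⟨mkDerivation K g, ?_⟩
  -- Every generator is a multiple of a variable, and there `φ` agrees with the derivation by the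
  -- choice of `g`.
  have key : ∀ F : Finset (Fin n), F ≠ ∅ → ∃ i, ∃ s : MvPolynomial (Fin n) K,
      (∏ i ∈ F, X i) = s * X i := fun F hF => by
    obtain ⟨i, hi⟩ := Finset.nonempty_iff_ne_empty.2 hF
    exact ⟨i, _, (Finset.prod_erase_mul _ _ hi).symm⟩
  ext ⟨f, hf⟩
  have hspan : ∀ f (hf : f ∈ Ideal.span {p | ∃ F : Finset (Fin n), F ∉ Δ ∧
      p = ∏ i ∈ F, (X i : MvPolynomial (Fin n) K)}),
      derToHom K (stanleyReisnerIdeal K Δ) (mkDerivation K g) ⟨f, hf⟩ = φ ⟨f, hf⟩ := by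
    intro f hf
    induction hf using Submodule.span_induction with
    | mem f hf =>
      obtain ⟨F, hF, rfl⟩ := hf
      obtain ⟨i, s, hs⟩ := key F (fun e => hF ((h F).2 e))
      have e : (⟨∏ i ∈ F, X i, Submodule.subset_span ⟨F, hF, rfl⟩⟩ : stanleyReisnerIdeal K Δ) =
          s • ⟨X i, hX i⟩ := Subtype.ext hs
      rw [e, map_smul, map_smul, ← hg]
      simp [derToHom]
    | zero => exact (map_zero _).trans (map_zero φ).symm
    | add x y hx hy ihx ihy =>
      exact (map_add _ (⟨x, hx⟩ : stanleyReisnerIdeal K Δ) ⟨y, hy⟩).trans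
        ((congrArg₂ (· + ·) ihx ihy).trans
          (map_add φ (⟨x, hx⟩ : stanleyReisnerIdeal K Δ) ⟨y, hy⟩).symm)
    | smul s x hx ih =>
      exact (map_smul _ s (⟨x, hx⟩ : stanleyReisnerIdeal K Δ)).trans
        ((congrArg (s • ·) ih).trans (map_smul φ s (⟨x, hx⟩ : stanleyReisnerIdeal K Δ)).symm)
  exact hspan f hf

theorem isRigid_of_forall_not_mem {Δ : SimplicialComplex n} (h : ∀ F, F ∉ Δ) :
    IsRigid K Δ := by
  have : stanleyReisnerIdeal K Δ = ⊤ := (Ideal.eq_top_iff_one _).2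
    (mem_stanleyReisnerIdeal_iff.2 fun p _ => h _)
  rw [isRigid_iff]
  intro φ
  have := Ideal.Quotient.subsingleton_iff.2 this
  exact ⟨0, LinearMap.ext fun x => Subsingleton.elim _ _⟩

theorem mem_link {Δ : SimplicialComplex n} {A B : Finset (Fin n)} :
    B ∈ link Δ A ↔ B ∈ Δ ∧ B ∩ A = ∅ ∧ B ∪ A ∈ Δ := Iff.rfl

/-- The link of a facet is rigid. -/
theorem isRigid_link_of_facet {Δ : SimplicialComplex n} {A : Finset (Fin n)} (hA : A ∈ Δ)
    (hmax : ∀ F ∈ Δ, A ⊆ F → F = A) : IsRigid K (link Δ A) := by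
  refine isRigid_of_forall_mem_iff fun F => ⟨?_, ?_⟩
  · rintro ⟨-, hd, hu⟩
    have := hmax _ hu Finset.subset_union_right
    rw [← hd, Finset.inter_eq_left.2 (Finset.union_eq_right.1 this)]
  · rintro rfl
    exact ⟨Δ.lower (Finset.empty_subset A) hA, by simp, by simpa using hA⟩

/-! ### Monomial shift homomorphisms -/

/-- The `K`-linear map `S → S/I` that sends the monomial `x^p` to the class of `x^(p-b+a)` if
`c ≤ p`, and to `0` otherwise. -/
noncomputable def shiftMap (I : Ideal (MvPolynomial (Fin n) K)) (c b a : Fin n →₀ ℕ) :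
    MvPolynomial (Fin n) K →ₗ[K] MvPolynomial (Fin n) K ⧸ I :=
  (basisMonomials (Fin n) K).constr K fun p =>
    open Classical in if c ≤ p then Ideal.Quotient.mk I (monomial (p - b + a) 1) else 0

theorem shiftMap_monomial_of_le (I : Ideal (MvPolynomial (Fin n) K)) {c b a p : Fin n →₀ ℕ}
    (h : c ≤ p) (k : K) :
    shiftMap I c b a (monomial p k) = Ideal.Quotient.mk I (monomial (p - b + a) k) := by
  have : (monomial p k : MvPolynomial (Fin n) K) = k • basisMonomials (Fin n) K p := by
    simp [smul_monomial]
  rw [this, map_smul, shiftMap, Module.Basis.constr_basis, if_pos h,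
    ← Ideal.Quotient.mkₐ_eq_mk K, ← map_smul]
  simp [smul_monomial]

theorem shiftMap_monomial_of_not_le (I : Ideal (MvPolynomial (Fin n) K)) {c b a p : Fin n →₀ ℕ}
    (h : ¬ c ≤ p) (k : K) : shiftMap I c b a (monomial p k) = 0 := by
  have : (monomial p k : MvPolynomial (Fin n) K) = k • basisMonomials (Fin n) K p := by
    simp [smul_monomial]
  rw [this, map_smul, shiftMap, Module.Basis.constr_basis, if_neg h, smul_zero]

/-- Linearity over `S` can only fail where multiplication by `x^q` turns a monomial of `I_Δ` sent to
`0` into one that is shifted; `h` makes the shifted image vanish in the quotient. `b ≤ c` keeps the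
subtraction from truncating. -/
theorem shiftMap_mul {Δ : SimplicialComplex n} {c b a : Fin n →₀ ℕ} (hbc : b ≤ c)
    (h : ∀ p q : Fin n →₀ ℕ, p.support ∉ Δ → ¬ c ≤ p → c ≤ q + p →
      (q + p - b + a).support ∉ Δ)
    (g : MvPolynomial (Fin n) K) {f : MvPolynomial (Fin n) K} (hf : f ∈ stanleyReisnerIdeal K Δ) :
    shiftMap (stanleyReisnerIdeal K Δ) c b a (g * f) =
      Ideal.Quotient.mk _ g * shiftMap (stanleyReisnerIdeal K Δ) c b a f := by
  have hf' := mem_stanleyReisnerIdeal_iff.1 hf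
  rw [f.as_sum, Finset.mul_sum, map_sum, map_sum, Finset.mul_sum]
  refine Finset.sum_congr rfl fun p hp => ?_
  rw [g.as_sum, Finset.sum_mul, map_sum, map_sum, Finset.sum_mul]
  refine Finset.sum_congr rfl fun q _ => ?_
  rw [monomial_mul]
  by_cases hc : c ≤ p
  · rw [shiftMap_monomial_of_le _ hc,
      shiftMap_monomial_of_le _ (hc.trans (self_le_add_left p q)), ← map_mul, monomial_mul,
      add_tsub_assoc_of_le (hbc.trans hc), add_assoc]
  · rw [shiftMap_monomial_of_not_le _ hc, mul_zero]
    by_cases hc' : c ≤ q + p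
    · rw [shiftMap_monomial_of_le _ hc', Ideal.Quotient.eq_zero_iff_mem]
      exact monomial_mem_stanleyReisnerIdeal (h p q (hf' p hp) hc hc') _
    · exact shiftMap_monomial_of_not_le _ hc' _

/-- If `Δ` is rigid, every well-defined shift homomorphism is induced by a derivation. -/
theorem exists_derivation_of_isRigid {Δ : SimplicialComplex n} (hΔ : IsRigid K Δ)
    {c b a : Fin n →₀ ℕ} (hbc : b ≤ c)
    (h : ∀ p q : Fin n →₀ ℕ, p.support ∉ Δ → ¬ c ≤ p → c ≤ q + p →
      (q + p - b + a).support ∉ Δ) :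
    ∃ D : Derivation K (MvPolynomial (Fin n) K) (MvPolynomial (Fin n) K),
      ∀ f ∈ stanleyReisnerIdeal K Δ,
        Ideal.Quotient.mk _ (D f) = shiftMap (stanleyReisnerIdeal K Δ) c b a f := by
  let φ : stanleyReisnerIdeal K Δ →ₗ[MvPolynomial (Fin n) K]
      MvPolynomial (Fin n) K ⧸ stanleyReisnerIdeal K Δ :=
    { toFun := fun f => shiftMap (stanleyReisnerIdeal K Δ) c b a f
      map_add' := fun f g => by simp
      map_smul' := fun s f => (shiftMap_mul hbc h s f.2).trans (Algebra.smul_def s _).symm }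
  obtain ⟨D, hD⟩ := isRigid_iff.1 hΔ φ
  exact ⟨D, fun f hf => LinearMap.congr_fun hD ⟨f, hf⟩⟩

/-! ### A criterion for non-rigidity -/

theorem coeff_X_mul_of_eq_zero {m : Fin n →₀ ℕ} {i : Fin n} (h : m i = 0)
    (f : MvPolynomial (Fin n) K) : coeff m (X i * f) = 0 := by
  classical
  rw [coeff_X_mul', if_neg (by simpa using h)]

/-- The coefficient of `x_w x^(2α)` in `D (x_u x_w x^α)`. -/
theorem coeff_derivation_mul_of_eq_zero
    (D : Derivation K (MvPolynomial (Fin n) K) (MvPolynomial (Fin n) K)) {u w : Fin n}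
    {α : Fin n →₀ ℕ} (huw : w ≠ u) (hu : α u = 0) :
    coeff (Finsupp.single w 1 + (α + α)) (D (X u * (X w * monomial α 1))) = coeff α (D (X u)) := by
  have h1 : D (X u * (X w * monomial α 1)) =
      X u * D (X w * monomial α 1) + X w * (monomial α 1 * D (X u)) := by
    rw [D.leibniz, smul_eq_mul, smul_eq_mul, mul_assoc]
  rw [h1, coeff_add, coeff_X_mul_of_eq_zero (by simp [hu, huw]), zero_add,
    add_comm, coeff_X_mul']
  classical
  rw [if_pos (by simp), add_tsub_cancel_right, coeff_monomial_mul, one_mul]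

/-- A complex with a face `α` whose link is a set of at least two points is not rigid. -/
theorem not_isRigid_of_link_discrete_points {Δ : SimplicialComplex n} {a : Finset (Fin n)}
    (hcard : ∀ F ∈ Δ, a ⊆ F → F.card ≤ a.card + 1) {u w : Fin n} (huw : u ≠ w)
    (hu : u ∉ a) (hw : w ∉ a) (huΔ : insert u a ∈ Δ) (hwΔ : insert w a ∈ Δ) :
    ¬ IsRigid K Δ := by
  classical
  intro hΔ
  -- Only the support of the exponent `α` is used below.
  obtain ⟨α, rfl⟩ : ∃ α : Fin n →₀ ℕ, α.support = a :=
    ⟨Finsupp.indicator a fun _ _ => 1, by ext; simp [Finsupp.indicator_apply]⟩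
  have hu0 := Finsupp.notMem_support_iff.1 hu
  have hw0 := Finsupp.notMem_support_iff.1 hw
  have hle : ∀ p : Fin n →₀ ℕ, Finsupp.single u 1 + Finsupp.single w 1 ≤ p ↔
      p u ≠ 0 ∧ p w ≠ 0 := by
    intro p
    constructor
    · intro h
      have h1 := h u
      have h2 := h w
      simp [huw, huw.symm] at h1 h2
      omega
    · rintro ⟨h1, h2⟩ j
      rcases eq_or_ne j u with rfl | hju
      · simp [huw.symm]; omega
      · rcases eq_or_ne j w with rfl | hjw
        · simp [hju.symm]; omega
        · simp [hju.symm, hjw.symm]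
  have hαα : (α + α).support = α.support := by ext; simp
  -- a nonface cannot lie in the union of the two faces without containing both points
  have hnot : ∀ p : Fin n →₀ ℕ, p.support ∉ Δ →
      ¬ Finsupp.single u 1 + Finsupp.single w 1 ≤ p →
      ¬ p.support ⊆ insert u (insert w α.support) := by
    intro p hp hc hsub
    rw [hle, not_and_or, not_not, not_not] at hc
    rcases hc with hc | hc
    · refine hp (Δ.lower (fun x hx => ?_) hwΔ)
      have := hsub hx
      rw [Finset.mem_insert] at this
      exact this.resolve_left (by rintro rfl; exact Finsupp.mem_support_iff.1 hx hc)
    · refine hp (Δ.lower (fun x hx => ?_) huΔ)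
      have := hsub hx
      rw [Finset.mem_insert, Finset.mem_insert] at this
      have hxw : x ≠ w := by rintro rfl; exact Finsupp.mem_support_iff.1 hx hc
      rw [Finset.mem_insert]
      tauto
  have hpair : ∀ v z : Fin n, v ≠ z → v ∉ α.support → z ∉ α.support →
      (X v * (X z * monomial α 1) : MvPolynomial (Fin n) K) ∈ stanleyReisnerIdeal K Δ := by
    intro v z hvz hv hz
    rw [X, X, monomial_mul, monomial_mul]
    refine monomial_mem_stanleyReisnerIdeal (fun hmem => ?_) _
    have hsub : insert v (insert z α.support) ⊆
        (Finsupp.single v 1 + (Finsupp.single z 1 + α)).support := by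
      intro x hx
      simp only [Finset.mem_insert, Finsupp.mem_support_iff] at hx
      simp only [Finsupp.mem_support_iff, Finsupp.add_apply, Finsupp.single_apply]
      rcases hx with rfl | rfl | hx
      · simp
      · simp
      · omega
    have h1 := hcard _ (Δ.lower hsub hmem)
      ((Finset.subset_insert _ _).trans (Finset.subset_insert _ _))
    rw [Finset.card_insert_of_notMem (by simp only [Finset.mem_insert]; tauto),
      Finset.card_insert_of_notMem hz] at h1
    omega
  have hcoeff : ∀ {f g : MvPolynomial (Fin n) K} {m : Fin n →₀ ℕ}, m.support ∈ Δ →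
      Ideal.Quotient.mk (stanleyReisnerIdeal K Δ) f = Ideal.Quotient.mk _ g →
      coeff m f = coeff m g := by
    intro f g m hm h
    have := coeff_eq_zero_of_mem_stanleyReisnerIdeal (Ideal.Quotient.eq.1 h) hm
    rwa [coeff_sub, sub_eq_zero] at this
  have hmon : ∀ v z : Fin n, (X v * (X z * monomial α 1) : MvPolynomial (Fin n) K) =
      monomial (Finsupp.single v 1 + (Finsupp.single z 1 + α)) 1 := by
    intro v z
    rw [X, X, monomial_mul, monomial_mul, one_mul, one_mul]
  have hface : ∀ v, insert v α.support ∈ Δ → (Finsupp.single v 1 + (α + α)).support ∈ Δ := by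
    intro v hv
    refine Δ.lower (fun x hx => ?_) hv
    simp only [Finset.mem_insert, Finsupp.mem_support_iff]
    simp only [Finsupp.mem_support_iff, Finsupp.add_apply, Finsupp.single_apply] at hx
    rcases eq_or_ne x v with rfl | h
    · exact Or.inl rfl
    · rw [if_neg h.symm] at hx
      right; omega
  -- With a third point `v`, the shift by `α - u` separates `w` from `v`; with only two points, the
  -- shift by `α - u - w` is used.
  by_cases hv : ∃ v, v ≠ u ∧ v ≠ w ∧ v ∉ α.support ∧ insert v α.support ∈ Δ
  · obtain ⟨v, hvu, hvw, hvα, hvΔ⟩ := hv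
    obtain ⟨D, hD⟩ := exists_derivation_of_isRigid (c := Finsupp.single u 1 + Finsupp.single w 1)
      (b := Finsupp.single u 1) (a := α) hΔ (self_le_add_right _ _) (by
        intro p q hp hc hc' hF
        refine hnot p hp hc fun x hx => ?_
        have hsub : insert w α.support ⊆ (q + p - Finsupp.single u 1 + α).support := by
          intro y hy
          have := (hle _).1 hc'
          simp only [Finset.mem_insert, Finsupp.mem_support_iff] at hy
          simp only [Finsupp.mem_support_iff, Finsupp.add_apply, Finsupp.tsub_apply,
            Finsupp.single_apply] at this ⊢
          rcases hy with rfl | hy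
          · rw [if_neg huw]; omega
          · omega
        -- If the shifted monomial had a face as support, `hcard` would force that face to be
        -- `insert w a`, confining `p` to `a ∪ {u, w}`, against `hnot`.
        have heq := Finset.eq_of_subset_of_card_le hsub (by
          rw [Finset.card_insert_of_notMem hw]
          exact hcard _ hF ((Finset.subset_insert _ _).trans hsub))
        rw [heq, Finset.mem_insert]
        rcases eq_or_ne x u with rfl | hxu
        · exact Or.inl rfl
        · right
          have := Finsupp.mem_support_iff.1 hx
          simp only [Finsupp.mem_support_iff, Finsupp.add_apply, Finsupp.tsub_apply,
            Finsupp.single_apply, if_neg hxu.symm]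
          omega)
    have h1 := hD _ (hpair u w huw hu hw)
    have h2 := hD _ (hpair u v hvu.symm hu hvα)
    rw [hmon u w, shiftMap_monomial_of_le _ ((hle _).2 (by simp [Finsupp.single_apply])),
      ← hmon u w, add_tsub_cancel_left, add_assoc] at h1
    rw [hmon u v, shiftMap_monomial_of_not_le _
      (by rw [hle]; simp [Finsupp.single_apply, huw, hvw, hw0]), ← hmon u v,
      ← map_zero (Ideal.Quotient.mk _)] at h2
    have h1' := hcoeff (hface w hwΔ) h1
    have h2' := hcoeff (hface v hvΔ) h2
    -- The coefficient of `x^α` in `D x_u` would be `1` when read off with `w`, but `0` when read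
    -- off with `v`.
    rw [coeff_derivation_mul_of_eq_zero D huw.symm hu0, coeff_monomial, if_pos rfl] at h1'
    rw [coeff_derivation_mul_of_eq_zero D hvu hu0, coeff_zero, h1'] at h2'
    exact one_ne_zero h2'
  · push Not at hv
    obtain ⟨D, hD⟩ := exists_derivation_of_isRigid (c := Finsupp.single u 1 + Finsupp.single w 1)
      (b := Finsupp.single u 1 + Finsupp.single w 1) (a := α) hΔ le_rfl (by
        intro p q hp hc hc' hF
        refine hnot p hp hc fun x hx => ?_
        by_contra hx'
        simp only [Finset.mem_insert, not_or] at hx'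
        -- A point `x` of `p` outside `a ∪ {u, w}` survives the shift, so it would be a third point
        -- of the link.
        refine hv x hx'.1 hx'.2.1 hx'.2.2 (Δ.lower (fun y hy => ?_) hF)
        have := Finsupp.mem_support_iff.1 hx
        simp only [Finset.mem_insert, Finsupp.mem_support_iff] at hy
        simp only [Finsupp.mem_support_iff, Finsupp.add_apply, Finsupp.tsub_apply,
          Finsupp.single_apply]
        rcases hy with rfl | hy
        · rw [if_neg (Ne.symm hx'.1), if_neg (Ne.symm hx'.2.1)]; omega
        · omega)
    have h1 := hD _ (hpair u w huw hu hw)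
    rw [hmon u w, shiftMap_monomial_of_le _ ((hle _).2 (by simp [Finsupp.single_apply])),
      ← hmon u w, ← add_assoc, add_tsub_cancel_left] at h1
    have h1' := hcoeff (m := α + α)
      (by rw [hαα]; exact Δ.lower (Finset.subset_insert _ _) huΔ) h1
    -- By Leibniz the image lies in `(x_u, x_w)`, so it has no `x^(2α)` term, whereas the shift
    -- gives exactly `x^(2α)`.
    have hDf : D (X u * (X w * monomial α 1)) =
        X u * D (X w * monomial α 1) + X w * (monomial α 1 * D (X u)) := by
      rw [D.leibniz, smul_eq_mul, smul_eq_mul, mul_assoc]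
    rw [hDf, coeff_add, coeff_X_mul_of_eq_zero (by simp [hu0]),
      coeff_X_mul_of_eq_zero (by simp [hw0]), coeff_monomial, if_pos rfl, add_zero] at h1'
    exact zero_ne_one h1'

/-! ### Rank bounds and links in matroids -/

theorem card_le_rank {Δ : SimplicialComplex n} {F : Finset (Fin n)} (hF : F ∈ Δ) :
    F.card ≤ rank Δ := by
  classical
  exact Finset.le_sup (f := Finset.card) (by simpa using hF)

theorem rank_ge_one_add_maxCardNonrigidLink (Δ : SimplicialComplex n) :
    1 + maxCardNonrigidLink K Δ ≤ (rank Δ : WithBot ℕ) := by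
  classical
  have key : ∀ A : Finset (Fin n), Nontrivial (T1 K (link Δ A)) → 1 + A.card ≤ rank Δ := by
    intro A hA
    have hnr : ¬ IsRigid K (link Δ A) := not_subsingleton_iff_nontrivial.2 hA
    have hAΔ : A ∈ Δ := by
      by_contra hAΔ
      exact hnr (isRigid_of_forall_not_mem fun F hF =>
        hAΔ (Δ.lower Finset.subset_union_right hF.2.2))
    by_contra hlt
    exact hnr (isRigid_link_of_facet hAΔ fun F hF hAF =>
      (Finset.eq_of_subset_of_card_le hAF (by have := card_le_rank hF; omega)).symm)
  cases hm : maxCardNonrigidLink K Δ with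
  -- Without non-rigid links the left side is `1 + ⊥ = ⊥`.
  | bot => simp
  | coe m =>
    obtain ⟨A, hA, rfl⟩ := Finset.mem_image.1 (Finset.mem_of_max hm)
    have h : ((1 + A.card : ℕ) : WithBot ℕ) ≤ rank Δ :=
      WithBot.coe_le_coe.2 (key A (by simpa using hA))
    rwa [Nat.cast_add, Nat.cast_one] at h

theorem mem_indepComplex {M : Matroid (Fin n)} {F : Finset (Fin n)} :
    F ∈ indepComplex M ↔ M.Indep (F : Set (Fin n)) := Iff.rfl

theorem rank_indepComplex {M : Matroid (Fin n)} {B : Finset (Fin n)}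
    (hB : M.IsBase (B : Set (Fin n))) : rank (indepComplex M) = B.card := by
  classical
  refine le_antisymm (Finset.sup_le fun F hF => ?_) (card_le_rank (mem_indepComplex.2 hB.indep))
  have hF' : M.Indep (F : Set (Fin n)) := by simpa [mem_indepComplex] using hF
  obtain ⟨B', hB', hsub⟩ := hF'.exists_isBase_superset
  have h1 := Set.ncard_le_ncard hsub B'.toFinite
  rwa [hB'.ncard_eq_ncard_of_isBase hB, Set.ncard_coe_finset, Set.ncard_coe_finset] at h1

/-- If `A` is properly contained in a basis `B` and some `u ∈ B \ A` is not a coloop, then the link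
of `A` is not rigid. -/
theorem not_isRigid_link_of_isBase {M : Matroid (Fin n)} {A B : Finset (Fin n)}
    (hB : M.IsBase (B : Set (Fin n))) (hAB : A ⊆ B) {u : Fin n} (huB : u ∈ B) (huA : u ∉ A)
    (hu : ¬ M.IsColoop u) : ¬ IsRigid K (link (indepComplex M) A) := by
  classical
  obtain ⟨B', hB', huB'⟩ : ∃ B', M.IsBase B' ∧ u ∉ B' := by
    by_contra! h
    exact hu (Matroid.isColoop_iff_forall_mem_isBase.2 fun B' hB' => h B' hB')
  obtain ⟨w, ⟨hwB', hwB⟩, hbase⟩ := hB.exchange hB' ⟨huB, huB'⟩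
  have hwB0 : w ∉ B := hwB
  have huw : u ≠ w := by rintro rfl; exact hwB0 huB
  have hmem : ∀ v : Fin n, v ∉ A → M.Indep (insert v ((B : Set (Fin n)) \ {u})) →
      insert v ((B \ A).erase u) ∈ link (indepComplex M) A := by
    intro v hv hind
    refine ⟨hind.subset ?_, ?_, hind.subset ?_⟩
    · intro x hx
      simp at hx ⊢
      tauto
    · ext x
      simp only [Finset.mem_inter, Finset.mem_insert, Finset.mem_erase, Finset.mem_sdiff,
        Finset.notMem_empty, iff_false]
      rintro ⟨rfl | h, hx⟩
      · exact hv hx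
      · exact h.2.2 hx
    · intro x hx
      simp at hx ⊢
      rcases hx with rfl | hx | hx
      · exact Or.inl rfl
      · tauto
      · exact Or.inr ⟨hAB hx, by rintro rfl; exact huA hx⟩
  refine not_isRigid_of_link_discrete_points (a := (B \ A).erase u) ?_ huw (by simp)
    (by simp [hwB0]) (hmem u huA ?_) (hmem w (fun h => hwB0 (hAB h)) hbase.indep)
  -- Faces of the link of `A` have at most `|B| - |A|` elements, one more than `(B \ A) \ {u}`.
  · rintro F ⟨-, hd, hF⟩ -
    have h1 := card_le_rank hF
    rw [rank_indepComplex hB,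
      Finset.card_union_of_disjoint (Finset.disjoint_iff_inter_eq_empty.2 hd)] at h1
    rw [Finset.card_erase_of_mem (by simp [huB, huA]), Finset.card_sdiff_of_subset hAB]
    have := Finset.card_le_card hAB
    omega
  · rw [Set.insert_sdiff_singleton, Set.insert_eq_of_mem (by exact huB)]
    exact hB.indep

theorem isRigid_link_indepComplex_iff {M : Matroid (Fin n)}
    (hM : ∀ v, ¬ M.IsColoop v) {A : Finset (Fin n)} (hA : A ∈ indepComplex M) :
    IsRigid K (link (indepComplex M) A) ↔ M.IsBase (A : Set (Fin n)) := by
  classical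
  constructor
  · intro h
    obtain ⟨B, hB, hAB⟩ := (mem_indepComplex.1 hA).exists_isBase_superset
    lift B to Finset (Fin n) using B.toFinite
    by_contra hAb
    have hne : ¬ B ⊆ A := fun hBA => hAb (by
      rwa [Finset.Subset.antisymm (Finset.coe_subset.1 hAB) hBA])
    obtain ⟨u, huB, huA⟩ := Finset.not_subset.1 hne
    exact not_isRigid_link_of_isBase hB (Finset.coe_subset.1 hAB) huB huA (hM u) h
  · intro h
    exact isRigid_link_of_facet hA fun F hF hAF =>
      (Finset.coe_injective (h.eq_of_subset_indep hF (Finset.coe_subset.2 hAF))).symm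

theorem rank_le_one_add_maxCardNonrigidLink {M : Matroid (Fin n)}
    (hM : ¬ IsDiscrete M) :
    (rank (indepComplex M) : WithBot ℕ) ≤ 1 + maxCardNonrigidLink K (indepComplex M) := by
  classical
  simp only [IsDiscrete, not_forall, not_or] at hM
  obtain ⟨v, hvE, hloop, hcoloop⟩ := hM
  -- Not being a loop puts `v` in a basis `B`; not being a coloop makes the link of `B \ {v}`
  -- non-rigid, which attains the bound.
  obtain ⟨B, hB, hvB⟩ :=
    (Matroid.indep_singleton.2 ((Matroid.not_isLoop_iff hvE).1 hloop)).exists_isBase_superset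
  lift B to Finset (Fin n) using B.toFinite
  have hv : v ∈ B := by simpa using hvB
  have hnr := not_isRigid_link_of_isBase (K := K) hB (Finset.erase_subset v B) hv
    (Finset.notMem_erase v B) hcoloop
  have hle : ((B.erase v).card : WithBot ℕ) ≤ maxCardNonrigidLink K (indepComplex M) := by
    refine Finset.le_max (Finset.mem_image_of_mem _ ?_)
    simpa using not_subsingleton_iff_nontrivial.1 hnr
  calc (rank (indepComplex M) : WithBot ℕ) = 1 + ((B.erase v).card : WithBot ℕ) := by
        rw [rank_indepComplex hB, ← Finset.card_erase_add_one hv, add_comm]; push_cast; rfl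
    _ ≤ _ := add_le_add_right hle 1

end StanleyReisner

theorem mainTheorem7 (K : Type*) [Field K] (n : ℕ) :
    (∀ Δ : StanleyReisner.SimplicialComplex n,
      (StanleyReisner.rank Δ : WithBot ℕ) ≥ 1 + StanleyReisner.maxCardNonrigidLink K Δ) ∧
    (∀ M : Matroid (Fin n), M.E = Set.univ → (∀ v, ¬ M.IsColoop v) →
      ∀ A : Finset (Fin n), A ∈ StanleyReisner.indepComplex M →
        (StanleyReisner.IsRigid K (StanleyReisner.link (StanleyReisner.indepComplex M) A) ↔
          M.IsBase (A : Set (Fin n)))) ∧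
    (∀ M : Matroid (Fin n), M.E = Set.univ → ¬ StanleyReisner.IsDiscrete M →
      (StanleyReisner.rank (StanleyReisner.indepComplex M) : WithBot ℕ) =
        1 + StanleyReisner.maxCardNonrigidLink K (StanleyReisner.indepComplex M)) :=
  ⟨StanleyReisner.rank_ge_one_add_maxCardNonrigidLink,
    fun _ _ hM _ hA => StanleyReisner.isRigid_link_indepComplex_iff hM hA,
    fun M _ hM => le_antisymm (StanleyReisner.rank_le_one_add_maxCardNonrigidLink hM)
      (StanleyReisner.rank_ge_one_add_maxCardNonrigidLink (StanleyReisner.indepComplex M))⟩
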